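/- A polytope $P$ is the convex hull of a finite set of points in a Euclidean space. Its faces are the empty set, $P$ itself, and the intersections of $P$ with its supporting hyperplanes; the dimension of a face is that of its affine hull, with $\dim\emptyset=-1$; vertices, edges and facets are the faces of dimension $0$, $1$ and $\dim P-1$. A treetope with base $B$ is a polytope $P$ together with a facet $B$ of $P$ such that every face of $P$ that intersects $B$ in at most one point has dimension at most one. Its canopy is the graph whose vertices are all the vertices of $P$ and whose edges are the edges of $P$ that are not contained in $B$. Theorem. Let $P$ be a treetope with base $B$, and let $T$ be its canopy. Then $T$ is a tree. For each nonempty face $F$ of $B$ there is exactly one face $F'$ of $P$ with $F'\neq F$ and $F'\cap B=F$; it is called the lift of $F$, and $\dim F'=\dim F+1$. The set of all faces of $P$ (including $\emptyset$ and $P$) is the disjoint union of the following three classes: (1) the faces of $B$ (including $\emptyset$ and $B$); (2) the vertices and the edges of $T$ that are disjoint from $B$; (3) the lifts $F'$ of the nonempty faces $F$ of $B$. Moreover, for each nonempty face $F$ of $B$, the lift $F'$ is a treetope with base $F$, and if $\dim F\ge 1$, then the canopy of $F'$ is the minimal subtree of $T$ connecting the vertices of $F$, that is, it is a subtree of $T$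 that contains all vertices of $F$ and it is contained in every subtree of $T$ that contains all vertices of $F$. -/

import Mathlib

/-! # Polytopes, treetopes and canopies -/

section Treetope

variable {E : Type*} [NormedAddCommGroup E] [InnerProductSpace ℝ E]

/-- A polytope is the convex hull of a finite set of points. -/
def IsPolytope (P : Set E) : Prop :=
  ∃ S : Set E, S.Finite ∧ P = convexHull ℝ S

/-- The faces of a polytope `P`: the empty set, and the sets of all points of `P` at which some
linear functional is maximal on `P` (the zero functional gives `P` itself). -/
def IsFace (P F : Set E) : Prop :=
  IsExposed ℝ P F

open Classical in
/-- The dimension of a set: `-1` for the empty set, and otherwise the dimension of the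
affine hull. -/
noncomputable def polyDim (F : Set E) : ℤ :=
  if F.Nonempty then (Module.finrank ℝ (vectorSpan ℝ F) : ℤ) else -1

/-- A facet is a face of dimension one less than the polytope. -/
def IsFacet (P B : Set E) : Prop :=
  IsFace P B ∧ polyDim B = polyDim P - 1

/-- `P` is a treetope with base `B`: `P` is a polytope, `B` is a facet of `P`, and every face of
`P` that meets `B` in at most one point has dimension at most one. -/
structure IsTreetope (P B : Set E) : Prop where
  isPolytope : IsPolytope P
  isFacet : IsFacet P B
  dim_le_one : ∀ G : Set E, IsFace P G → (G ∩ B).Subsingleton → polyDim G ≤ 1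

/-- The vertices of `P`: the points that are faces of `P`. -/
def vertexSet (P : Set E) : Set E :=
  {x | IsFace P {x}}

/-- The canopy of `P` with respect to `B`: the graph formed by the vertices of `P` and those edges
of `P` that do not lie in `B`. It is a subgraph of the complete graph on the points of the
ambient space, so that the canopies of `P` and of its faces can be compared. -/
def canopy (P B : Set E) : (⊤ : SimpleGraph E).Subgraph where
  verts := vertexSet P
  Adj x y := x ≠ y ∧ x ∈ vertexSet P ∧ y ∈ vertexSet P ∧
    IsFace P (segment ℝ x y) ∧ ¬ segment ℝ x y ⊆ B
  adj_sub h := h.1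
  edge_vert h := h.2.1
  symm := ⟨fun x y h => by
    rw [segment_symm ℝ x y] at h
    exact ⟨h.1.symm, h.2.2.1, h.2.1, h.2.2.2⟩⟩

/-- `F'` is a lift of the face `F` of `B`: a face of `P` other than `F` that meets `B`
exactly in `F`. -/
def IsLift (P B F F' : Set E) : Prop :=
  IsFace P F' ∧ F' ≠ F ∧ F' ∩ B = F

/-- The faces of `P` that are vertices or edges of the canopy and are disjoint from `B`. -/
def upperCanopyFaces (P B : Set E) : Set (Set E) :=
  {G | Disjoint G B ∧ ((∃ x ∈ (canopy P B).verts, G = {x}) ∨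
    ∃ x y, (canopy P B).Adj x y ∧ G = segment ℝ x y)}

/-- The faces of `P` that are lifts of nonempty faces of `B`. -/
def liftedFaces (P B : Set E) : Set (Set E) :=
  {G | ∃ F : Set E, IsFace B F ∧ F.Nonempty ∧ IsLift P B F G}

/-- `S` is the minimal subtree of `T` connecting the vertices in `A`: it is a subtree of `T`
containing `A`, and it is contained in every other such subtree. -/
def IsMinimalSubtree {V : Type*} {G : SimpleGraph V} (T : G.Subgraph) (A : Set V)
    (S : G.Subgraph) : Prop :=
  IsLeast {S' : G.Subgraph | S' ≤ T ∧ S'.coe.IsTree ∧ A ⊆ S'.verts} S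

end Treetope

/-! ### Faces, vertices and edges of polytopes. -/

section Polytope

variable {E : Type*} [NormedAddCommGroup E] [InnerProductSpace ℝ E]

/-! Fix a height: a functional `l` with `c ≤ l` on `P` and `B` the set of points of `P` at height
`c`. Everything rests on `IsTreetope.eq_of_isFace_segment_of_le`: from each vertex at most one edge
leads, without descending, to a vertex off `B`. Two such edges would allow a supporting hyperplane
to be rotated about one of them into a face of dimension at least two that meets `B` at most in the
starting vertex.

The canopy is acyclic because the lowest vertex of a cycle would start two such edges. It is
connected because every vertex climbs, as in the simplex method
(`IsPolytope.exists_increasing_edge`), to the top face, which misses `B` and is therefore a point or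
an edge.

A lift of `F` comes from rotating a supporting hyperplane about `F` (`IsFace.exists_ssuperset`). At
a vertex of `F` it has a single rising edge, which gives its dimension and, since any two lifts
share that edge, its uniqueness. A lift is again a treetope, so its canopy is a tree; if `dim F ≥
1`, the leaves of that tree lie in `F`, which makes it minimal. -/

theorem isFace_of_forall_le {P : Set E} {m : StrongDual ℝ E} {c : ℝ} (h : ∀ x ∈ P, m x ≤ c) :
    IsFace P {x ∈ P | m x = c} := by
  rintro ⟨w, hw, hwc⟩
  refine ⟨m, Set.ext fun x => ⟨fun hx => ⟨hx.1, fun y hy => hx.2 ▸ h y hy⟩, fun hx => ⟨hx.1, ?_⟩⟩⟩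
  exact le_antisymm (h x hx.1) (hwc ▸ hx.2 w hw)

theorem IsFace.exists_functional {P F : Set E} (h : IsFace P F) (hF : F.Nonempty) :
    ∃ (m : StrongDual ℝ E) (c : ℝ), (∀ x ∈ P, m x ≤ c) ∧ F = {x ∈ P | m x = c} := by
  obtain ⟨m, hm⟩ := h hF
  obtain ⟨w, hw⟩ := hF
  have hw' := hw
  rw [hm] at hw'
  refine ⟨m, m w, hw'.2, hm.trans (Set.ext fun x => ⟨fun hx => ⟨hx.1, ?_⟩, fun hx => ⟨hx.1, ?_⟩⟩)⟩
  · exact le_antisymm (hw'.2 x hx.1) (hx.2 w hw'.1)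
  · intro y hy
    rw [hx.2]
    exact hw'.2 y hy

theorem IsFace.subset {P F : Set E} (h : IsFace P F) : F ⊆ P := IsExposed.subset h

theorem IsFace.inter {P F G : Set E} (hF : IsFace P F) (hG : IsFace P G) : IsFace P (F ∩ G) :=
  IsExposed.inter hF hG

theorem IsFace.mono {P F G : Set E} (hF : IsFace P F) (hGP : G ⊆ P) (hFG : F ⊆ G) : IsFace G F :=
  IsExposed.mono hF hGP hFG

theorem isFace_refl (P : Set E) : IsFace P P := IsExposed.refl P

theorem IsPolytope.convex {P : Set E} (hP : IsPolytope P) : Convex ℝ P := by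
  obtain ⟨S, -, rfl⟩ := hP
  exact convex_convexHull ℝ S

theorem IsPolytope.isCompact {P : Set E} (hP : IsPolytope P) : IsCompact P := by
  obtain ⟨S, hS, rfl⟩ := hP
  exact hS.isCompact_convexHull ℝ

theorem IsPolytope.isFace {P F : Set E} (hP : IsPolytope P) (hF : IsFace P F) : IsPolytope F := by
  have hc : IsCompact F := IsExposed.isCompact hF hP.isCompact
  have hco : Convex ℝ F := IsExposed.convex hF hP.convex
  obtain ⟨S, hS, rfl⟩ := hP
  have hfin : (F.extremePoints ℝ).Finite := hS.subset <|
    (IsExposed.isExtreme hF).extremePoints_subset_extremePoints.trans extremePoints_convexHull_subset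
  refine ⟨_, hfin, ?_⟩
  rw [← (hfin.isCompact_convexHull ℝ).isClosed.closure_eq, closure_convexHull_extremePoints hc hco]

theorem functional_le_of_mem_convexHull {S : Set E} {m : StrongDual ℝ E} {c : ℝ}
    (h : ∀ x ∈ S, m x ≤ c) : ∀ x ∈ convexHull ℝ S, m x ≤ c :=
  fun _ hx => convexHull_min h (convex_halfSpace_le m.toLinearMap.isLinear c) hx

/-- A large multiple of the functional defining `F`, added to the one defining `K`, is maximal on
`P` along `K`. Finitely many generators make a finite multiple suffice. -/
theorem IsFace.trans {P F K : Set E} (hP : IsPolytope P) (hF : IsFace P F) (hK : IsFace F K) :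
    IsFace P K := by
  rcases K.eq_empty_or_nonempty with rfl | hne
  · exact isExposed_empty
  obtain ⟨m, M, hm, hFm⟩ := hF.exists_functional (hne.mono hK.subset)
  obtain ⟨k, c, hk, hKk⟩ := hK.exists_functional hne
  obtain ⟨S, hS, rfl⟩ := hP
  obtain ⟨N, hN⟩ : ∃ N : ℝ, ∀ s ∈ S, m s < M → k s - c ≤ N * (M - m s) := by
    obtain ⟨N, hN⟩ := (hS.image fun s => (k s - c) / (M - m s)).bddAbove
    refine ⟨N, fun s hs hsM => ?_⟩
    have := hN (Set.mem_image_of_mem _ hs)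
    rwa [div_le_iff₀ (sub_pos.2 hsM)] at this
  have key : ∀ x ∈ convexHull ℝ S, (N • m + k) x ≤ N * M + c := by
    refine functional_le_of_mem_convexHull fun s hs => ?_
    have hsP := subset_convexHull ℝ S hs
    simp only [add_apply, smul_apply, smul_eq_mul]
    rcases (hm s hsP).lt_or_eq with h | h
    · linarith [hN s hs h]
    · have := hk s (hFm ▸ ⟨hsP, h⟩)
      rw [h]
      linarith
  -- The bound `key` may be attained outside `F`; one more copy of `m` forces `m x = M` in the
  -- equality case.
  have key' : ∀ x ∈ convexHull ℝ S, (m + (N • m + k)) x ≤ M + (N * M + c) := fun x hx =>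
    add_le_add (hm x hx) (key x hx)
  convert isFace_of_forall_le key' using 1
  rw [hKk]
  ext x
  simp only [Set.mem_ofPred_eq, add_apply, smul_apply,
    smul_eq_mul]
  constructor
  · rintro ⟨hx, hxc⟩
    rw [hFm] at hx
    exact ⟨hx.1, by rw [hx.2, hxc]⟩
  · rintro ⟨hx, hxc⟩
    have h1 := hm x hx
    have h2 := key x hx
    simp only [add_apply, smul_apply, smul_eq_mul] at h2
    have h3 : m x = M := by linarith
    rw [h3] at hxc
    exact ⟨hFm ▸ ⟨hx, h3⟩, by linarith⟩

/-- Rotating the supporting hyperplane of a face `F` about `F` until it hits the part of `P` on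
which the functional `g` exceeds its constant value on `F`. -/
theorem IsFace.exists_ssuperset {P F : Set E} (hP : IsPolytope P) (hF : IsFace P F)
    (hne : F.Nonempty) {g : StrongDual ℝ E} {c : ℝ} (hg : ∀ x ∈ F, g x = c) {p : E} (hp : p ∈ P)
    (hpc : c < g p) :
    ∃ G, IsFace P G ∧ F ⊂ G ∧ ∀ x ∈ G, x ∉ F → c < g x := by
  obtain ⟨m, M, hm, hFm⟩ := hF.exists_functional hne
  obtain ⟨S, hS, rfl⟩ := hP
  obtain ⟨s₀, hs₀, hs₀c⟩ : ∃ s ∈ S, c < g s := by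
    by_contra! h
    exact (functional_le_of_mem_convexHull h p hp).not_gt hpc
  have hlt : ∀ s ∈ S, c < g s → m s < M := fun s hs hsc =>
    (hm s (subset_convexHull ℝ S hs)).lt_of_ne fun h =>
      hsc.ne' (hg s (hFm ▸ ⟨subset_convexHull ℝ S hs, h⟩))
  -- The generator of steepest slope is the first one hit by the rotating hyperplane; its slope `t`
  -- is the weight of `m` in the new supporting functional.
  obtain ⟨s, ⟨hs, hsc⟩, hmax⟩ := Set.exists_max_image {s ∈ S | c < g s}
    (fun s => (g s - c) / (M - m s)) (hS.subset (Set.sep_subset _ _)) ⟨s₀, hs₀, hs₀c⟩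
  set t := (g s - c) / (M - m s) with ht
  have hsM := sub_pos.2 (hlt s hs hsc)
  have htpos : 0 < t := div_pos (sub_pos.2 hsc) hsM
  have key : ∀ x ∈ convexHull ℝ S, (g + t • m) x ≤ c + t * M := by
    refine functional_le_of_mem_convexHull fun y hy => ?_
    have hyM := hm y (subset_convexHull ℝ S hy)
    simp only [add_apply, smul_apply, smul_eq_mul]
    by_cases hyc : c < g y
    · have := hmax y ⟨hy, hyc⟩
      rw [div_le_iff₀ (sub_pos.2 (hlt y hy hyc))] at this
      linarith
    · have := mul_le_mul_of_nonneg_left hyM htpos.le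
      linarith
  refine ⟨_, isFace_of_forall_le key, ⟨fun x hx => ?_, fun h => ?_⟩, ?_⟩
  · have hx' := hx
    rw [hFm] at hx'
    exact ⟨hx'.1, by simp [hg x hx, hx'.2]⟩
  · have : s ∈ F := h ⟨subset_convexHull ℝ S hs, by
      simp only [add_apply, smul_apply, smul_eq_mul]
      rw [div_eq_iff hsM.ne'] at ht
      linarith⟩
    exact hsc.ne' (hg s this)
  · rintro x ⟨hx, hxc⟩ hxF
    simp only [add_apply, smul_apply, smul_eq_mul] at hxc
    have hxM : m x < M := (hm x hx).lt_of_ne fun h => hxF (hFm ▸ ⟨hx, h⟩)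
    have := mul_lt_mul_of_pos_left hxM htpos
    linarith

theorem polyDim_of_nonempty {F : Set E} (h : F.Nonempty) :
    polyDim F = Module.finrank ℝ (vectorSpan ℝ F) := if_pos h

theorem polyDim_empty : polyDim (∅ : Set E) = -1 := if_neg Set.not_nonempty_empty

theorem polyDim_singleton (x : E) : polyDim {x} = 0 := by
  rw [polyDim_of_nonempty (Set.singleton_nonempty x), vectorSpan_singleton]
  simp

theorem IsFace.vertexSet_subset {P F : Set E} (hP : IsPolytope P) (hF : IsFace P F) :
    vertexSet F ⊆ vertexSet P := fun _ hx => IsFace.trans hP hF hx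

theorem mem_of_mem_vertexSet {P : Set E} {v : E} (hv : v ∈ vertexSet P) : v ∈ P :=
  IsFace.subset hv rfl

theorem mem_extremePoints_of_mem_vertexSet {P : Set E} {v : E} (hv : v ∈ vertexSet P) :
    v ∈ P.extremePoints ℝ :=
  isExtreme_singleton.1 (IsExposed.isExtreme hv)

theorem IsPolytope.finite_vertexSet {P : Set E} (hP : IsPolytope P) : (vertexSet P).Finite := by
  obtain ⟨S, hS, rfl⟩ := hP
  exact hS.subset fun v hv => extremePoints_convexHull_subset (mem_extremePoints_of_mem_vertexSet hv)

theorem eq_or_eq_of_mem_vertexSet_of_mem_segment {P : Set E} {v x y : E} (hv : v ∈ vertexSet P)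
    (hx : x ∈ P) (hy : y ∈ P) (h : v ∈ segment ℝ x y) : v = x ∨ v = y := by
  have := (mem_extremePoints_iff_forall_segment.1 (mem_extremePoints_of_mem_vertexSet hv)).2
    x hx y hy h
  tauto

variable [FiniteDimensional ℝ E]

theorem IsFace.polyDim_lt {P F : Set E} (hF : IsFace P F) (hne : F ≠ P) :
    polyDim F < polyDim P := by
  rcases F.eq_empty_or_nonempty with rfl | hFne
  · rw [polyDim_empty, polyDim_of_nonempty (Set.nonempty_iff_ne_empty.2 hne.symm)]
    omega
  obtain ⟨m, M, hm, hFm⟩ := hF.exists_functional hFne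
  rw [polyDim_of_nonempty hFne, polyDim_of_nonempty (hFne.mono hF.subset), Nat.cast_lt]
  refine Submodule.finrank_lt_finrank_of_lt
    (SetLike.lt_iff_le_and_exists.2 ⟨vectorSpan_mono ℝ hF.subset, ?_⟩)
  obtain ⟨x, hx, hxF⟩ : ∃ x ∈ P, x ∉ F := by
    by_contra! h
    exact hne (hF.subset.antisymm h)
  obtain ⟨y, hy⟩ := hFne
  refine ⟨x -ᵥ y, vsub_mem_vectorSpan ℝ hx (hF.subset hy), fun h => ?_⟩
  have hker : vectorSpan ℝ F ≤ LinearMap.ker m.toLinearMap := by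
    rw [vectorSpan, Submodule.span_le]
    rintro _ ⟨a, ha, b, hb, rfl⟩
    rw [hFm] at ha hb
    simp [ha.2, hb.2]
  have h1 := hker h
  have hy' := hy
  rw [hFm] at hy'
  have h2 : m x - m y = 0 := by simpa using h1
  exact hxF (hFm ▸ ⟨hx, by linarith [hy'.2]⟩)

theorem IsFace.polyDim_le {P F : Set E} (hF : IsFace P F) : polyDim F ≤ polyDim P := by
  rcases eq_or_ne F P with rfl | h
  · exact le_rfl
  · exact (hF.polyDim_lt h).le

theorem exists_functional_of_notMem {W : Submodule ℝ E} {x : E} (hx : x ∉ W) :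
    ∃ f : StrongDual ℝ E, 0 < f x ∧ ∀ w ∈ W, f w = 0 := by
  obtain ⟨f, hfx, hf⟩ := Submodule.exists_le_ker_of_notMem hx
  rcases hfx.lt_or_gt with h | h
  · exact ⟨-f.toContinuousLinearMap, by simpa using h, fun w hw => by simpa using hf hw⟩
  · exact ⟨f.toContinuousLinearMap, by simpa using h, fun w hw => by simpa using hf hw⟩

/-- `G` does not fit on the line through `v` and `p`. Rotating about `v` with this `q` produces a
face that avoids `p`, or an edge other than the one through `p`. -/
theorem exists_functional_of_one_lt_polyDim {G : Set E} (hG : 1 < polyDim G) {v : E} (hv : v ∈ G)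
    (p : E) : ∃ q : StrongDual ℝ E, q p = q v ∧ ∃ x ∈ G, q v < q x := by
  obtain ⟨x, hx, hxp⟩ : ∃ x ∈ G, x - v ∉ Submodule.span ℝ {p - v} := by
    by_contra! h
    rw [polyDim_of_nonempty ⟨v, hv⟩] at hG
    have : Collinear ℝ G := by
      rw [collinear_iff_of_mem hv]
      refine ⟨p - v, fun x hx => ?_⟩
      obtain ⟨r, hr⟩ := Submodule.mem_span_singleton.1 (h x hx)
      exact ⟨r, by simp [hr]⟩
    have := collinear_iff_finrank_le_one.1 this
    omega
  obtain ⟨q, hq, hq0⟩ := exists_functional_of_notMem hxp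
  have := hq0 _ (Submodule.mem_span_singleton_self _)
  rw [map_sub] at this hq
  exact ⟨q, by linarith, x, hx, by linarith⟩

/-- Induction on dimension: the face where a functional separating two points is maximal is proper.
-/
theorem IsPolytope.vertexSet_nonempty {P : Set E} (hP : IsPolytope P) (hne : P.Nonempty) :
    (vertexSet P).Nonempty := by
  induction h : Module.finrank ℝ (vectorSpan ℝ P) using Nat.strong_induction_on generalizing P with
  | _ n ih =>
  subst h
  obtain ⟨v, hv⟩ := hne
  by_cases hsub : P = {v}
  · exact ⟨v, hsub ▸ isFace_refl P⟩
  obtain ⟨w, hw, hwv⟩ : ∃ w ∈ P, w ≠ v := by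
    by_contra! h
    exact hsub (Set.eq_singleton_iff_unique_mem.2 ⟨hv, h⟩)
  obtain ⟨f, hf, -⟩ := exists_functional_of_notMem (W := ⊥) (x := w - v)
    (by simpa [sub_eq_zero] using hwv)
  obtain ⟨x, hx, hmax⟩ := hP.isCompact.exists_isMaxOn ⟨v, hv⟩ f.continuous.continuousOn
  have hF := isFace_of_forall_le (m := f) (c := f x) hmax
  have hvF : v ∉ {y ∈ P | f y = f x} := fun h => by
    have := hmax hw
    simp only [Set.mem_ofPred_eq, map_sub] at this h hf
    linarith [h.2]
  have hFne : {y ∈ P | f y = f x}.Nonempty := ⟨x, hx, rfl⟩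
  have hlt := hF.polyDim_lt fun h => hvF (h.ge hv)
  rw [polyDim_of_nonempty hFne, polyDim_of_nonempty ⟨v, hv⟩, Nat.cast_lt] at hlt
  exact (ih _ hlt (hP.isFace hF) hFne rfl).mono (hF.vertexSet_subset hP)

/-- The functional exposing `v` is injective on the line containing `G`, so its minimizer is the
other end. -/
theorem IsPolytope.eq_segment_of_polyDim_le_one {G : Set E} (hG : IsPolytope G)
    (hdim : polyDim G ≤ 1) {v : E} (hv : v ∈ vertexSet G) (hne : G ≠ {v}) :
    ∃ w ∈ vertexSet G, w ≠ v ∧ G = segment ℝ v w := by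
  have hvG := mem_of_mem_vertexSet hv
  obtain ⟨m, M, hm, hvm⟩ := IsFace.exists_functional hv (Set.singleton_nonempty v)
  have hM : m v = M := by
    have : v ∈ ({v} : Set E) := rfl
    rw [hvm] at this
    exact this.2
  have hinj : ∀ x ∈ G, m x = M → x = v := fun x hx h => by
    have : x ∈ ({v} : Set E) := hvm ▸ ⟨hx, h⟩
    exact this
  obtain ⟨b, hb, hmin⟩ := hG.isCompact.exists_isMinOn ⟨v, hvG⟩ m.continuous.continuousOn
  have hbv : b ≠ v := by
    rintro rfl
    refine hne (Set.eq_singleton_iff_unique_mem.2 ⟨hvG, fun x hx => hinj x hx ?_⟩)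
    have : m b ≤ m x := hmin hx
    linarith [hm x hx]
  have hbM : m b < M := (hm b hb).lt_of_ne fun h => hbv (hinj b hb h)
  rw [polyDim_of_nonempty ⟨v, hvG⟩] at hdim
  have hcol : Collinear ℝ G := collinear_iff_finrank_le_one.2 (by exact_mod_cast hdim)
  obtain ⟨u, hu⟩ := (collinear_iff_of_mem hvG).1 hcol
  obtain ⟨s, hs⟩ := hu b hb
  rw [vadd_eq_add] at hs
  have hms : m b = s * m u + M := by rw [hs, map_add, map_smul, hM, smul_eq_mul]
  have hs0 : s ≠ 0 := by
    rintro rfl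
    linarith
  have key : ∀ x ∈ G, x = AffineMap.lineMap v b ((M - m x) / (M - m b)) := by
    intro x hx
    obtain ⟨r, hr⟩ := hu x hx
    rw [vadd_eq_add] at hr
    have hmr : m x = r * m u + M := by rw [hr, map_add, map_smul, hM, smul_eq_mul]
    have hmu : m u ≠ 0 := by
      intro h
      rw [h] at hms
      linarith
    have : (M - m x) / (M - m b) = r / s := by
      rw [div_eq_div_iff (by linarith) hs0, hms, hmr]
      ring
    rw [this, AffineMap.lineMap_apply, vsub_eq_sub, vadd_eq_add, hr, hs, add_sub_cancel_right,
      smul_smul, div_mul_cancel₀ _ hs0]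
  refine ⟨b, ?_, hbv, (hG.convex.segment_subset hvG hb).antisymm' fun x hx => ?_⟩
  · have hF := isFace_of_forall_le (P := G) (m := -m) (c := -m b) fun x hx => by
      simpa using hmin hx
    suffices h : {b} = {x ∈ G | (-m) x = -m b} from (h ▸ hF : IsFace G {b})
    ext x
    constructor
    · rintro rfl
      exact ⟨hb, rfl⟩
    · rintro ⟨hx, hxb⟩
      have hxb : m x = m b := by simpa using hxb
      have := key x hx
      rw [hxb, div_self (by linarith), AffineMap.lineMap_apply_one] at this
      exact this
  · rw [segment_eq_image_lineMap]
    have : m b ≤ m x := hmin hx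
    have := hm x hx
    refine ⟨_, ⟨div_nonneg (by linarith) (by linarith), ?_⟩, (key x hx).symm⟩
    rw [div_le_one (by linarith)]
    linarith

/-- Induction on dimension: above dimension one, rotating about `v` gives a proper face that
strictly contains `v`. -/
theorem IsPolytope.exists_edge {G : Set E} (hG : IsPolytope G) {v : E} (hv : v ∈ vertexSet G)
    (hne : G ≠ {v}) : ∃ w ∈ vertexSet G, w ≠ v ∧ IsFace G (segment ℝ v w) := by
  have hvG := mem_of_mem_vertexSet hv
  induction h : Module.finrank ℝ (vectorSpan ℝ G) using Nat.strong_induction_on generalizing G with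
  | _ n ih =>
  subst h
  by_cases hdim : polyDim G ≤ 1
  · obtain ⟨w, hw, hwv, hGw⟩ := hG.eq_segment_of_polyDim_le_one hdim hv hne
    exact ⟨w, hw, hwv, hGw ▸ isFace_refl G⟩
  obtain ⟨p, hp, hpv⟩ : ∃ p ∈ G, p ≠ v := by
    by_contra! h
    exact hne (Set.eq_singleton_iff_unique_mem.2 ⟨hvG, h⟩)
  obtain ⟨q, hqp, x, hx, hqx⟩ := exists_functional_of_one_lt_polyDim (not_le.1 hdim) hvG p
  obtain ⟨K, hK, hvK, hKq⟩ := IsFace.exists_ssuperset hG hv (Set.singleton_nonempty v)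
    (g := q) (c := q v) (by simp) hx hqx
  have hvK' : v ∈ K := hvK.1 rfl
  have hpK : p ∉ K := fun h => (hKq p h (by simpa using hpv)).ne' hqp
  have hlt := hK.polyDim_lt fun h => hpK (h ▸ hp)
  rw [polyDim_of_nonempty ⟨v, hvK'⟩, polyDim_of_nonempty ⟨v, hvG⟩, Nat.cast_lt] at hlt
  obtain ⟨w, hw, hwv, hKw⟩ := ih _ hlt (hG.isFace hK)
    (IsFace.mono hv hK.subset (by simpa using hvK')) hvK.ne' hvK' rfl
  exact ⟨w, hK.vertexSet_subset hG hw, hwv, IsFace.trans hG hK hKw⟩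

/-- The simplex step: rotating about `v` gives a face on which `g` exceeds `g v` everywhere but at
`v`, so any edge of it at `v` will do. -/
theorem IsPolytope.exists_increasing_edge {P : Set E} (hP : IsPolytope P) {v : E}
    (hv : v ∈ vertexSet P) (g : StrongDual ℝ E) {p : E} (hp : p ∈ P) (h : g v < g p) :
    ∃ w ∈ vertexSet P, g v < g w ∧ IsFace P (segment ℝ v w) := by
  obtain ⟨K, hK, hvK, hKq⟩ := IsFace.exists_ssuperset hP hv (Set.singleton_nonempty v)
    (g := g) (c := g v) (by simp) hp h
  obtain ⟨w, hw, hwv, hKw⟩ := (hP.isFace hK).exists_edge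
    (IsFace.mono hv hK.subset hvK.1) hvK.ne'
  exact ⟨w, hK.vertexSet_subset hP hw, hKq w (mem_of_mem_vertexSet hw) (by simpa using hwv),
    IsFace.trans hP hK hKw⟩

theorem IsFace.one_le_polyDim_of_ssubset {P : Set E} {v : E} (hv : v ∈ vertexSet P)
    (h : P ≠ {v}) : 1 ≤ polyDim P := by
  have := IsFace.polyDim_lt hv h.symm
  rw [polyDim_singleton] at this
  omega

end Polytope

/-! ### Acyclic graphs and minimal subtrees. -/

section Graph

open SimpleGraph

variable {V : Type*}

/-- A vertex of a cycle minimizing `f` has two distinct neighbours on it, neither of them lower. -/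
theorem SimpleGraph.isAcyclic_of_subsingleton_ge {G : SimpleGraph V} (f : V → ℝ)
    (h : ∀ v a b, G.Adj v a → G.Adj v b → f v ≤ f a → f v ≤ f b → a = b) : G.IsAcyclic := by
  classical
  intro u p hp
  obtain ⟨v, hv, hmin⟩ := p.support.toFinset.exists_min_image f ⟨u, by simp⟩
  rw [List.mem_toFinset] at hv
  have hmin' : ∀ w ∈ (p.rotate v hv).support, f v ≤ f w := fun w hw =>
    hmin w (by simpa using (p.mem_support_rotate_iff v hv).1 hw)
  have hc : (p.rotate v hv).IsCycle := (Walk.isCycle_rotate hv).2 hp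
  refine hc.snd_ne_penultimate (h v _ _ (Walk.adj_snd hc.not_nil)
    (Walk.adj_penultimate hc.not_nil).symm (hmin' _ (Walk.getVert_mem_support _ _))
    (hmin' _ (Walk.getVert_mem_support _ _)))

/-- Outside `A` a path can always leave its endpoint by another edge; acyclicity keeps it a path,
and finiteness makes it stop, necessarily in `A`. -/
theorem SimpleGraph.IsAcyclic.exists_path_extension {G : SimpleGraph V} (hG : G.IsAcyclic)
    {W A : Set V} (hW : W.Finite) (hGW : ∀ x y, G.Adj x y → x ∈ W)
    (hdeg : ∀ x ∈ W, x ∉ A → ∃ a b, a ≠ b ∧ G.Adj x a ∧ G.Adj x b)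
    {u v : V} (p : G.Walk u v) (hp : p.IsPath) (hnil : ¬ p.Nil) :
    ∃ w ∈ A, ∃ q : G.Walk u w, q.IsPath ∧ p.edges ⊆ q.edges := by
  classical
  have hbound : ∀ {v : V} (p : G.Walk u v), p.IsPath → ¬ p.Nil → p.length < W.ncard := by
    intro v p hp hnil
    have hsub : (p.support.toFinset : Set V) ⊆ W := by
      intro x hx
      rw [List.coe_toFinset] at hx
      obtain ⟨e, he, hxe⟩ := (p.mem_support_iff_exists_mem_edges_of_not_nil hnil).1 hx
      obtain ⟨y, rfl⟩ := hxe
      exact hGW x y (p.adj_of_mem_edges he)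
    have := Set.ncard_le_ncard hsub hW
    rw [Set.ncard_coe_finset, List.toFinset_card_of_nodup hp.support_nodup,
      Walk.length_support] at this
    omega
  induction h : W.ncard - p.length using Nat.strong_induction_on generalizing v with
  | _ n ih =>
  subst h
  by_cases hv : v ∈ A
  · exact ⟨v, hv, p, hp, fun _ => id⟩
  have hpen := (Walk.adj_penultimate hnil).symm
  obtain ⟨a, ha, hva⟩ : ∃ a, a ≠ p.penultimate ∧ G.Adj v a := by
    obtain ⟨a, b, hab, hva, hvb⟩ := hdeg v (hGW _ _ hpen) hv
    by_cases h : a = p.penultimate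
    · exact ⟨b, fun hb => hab (h.trans hb.symm), hvb⟩
    · exact ⟨a, h, hva⟩
  have hap : a ∉ p.support := fun h => ha (hG.eq_penultimate_of_adj_end hp hva h)
  have hlt := hbound p hp hnil
  obtain ⟨w, hw, q, hq, hpq⟩ := ih _ (by rw [Walk.length_concat]; omega) (p.concat hva)
    (hp.concat hap hva) (by simp [Walk.not_nil_iff_lt_length]) rfl
  exact ⟨w, hw, q, hq, fun e he => hpq (by simp [Walk.edges_concat, he])⟩

/-- Each edge of `T'` lies on a path of `T'` with both ends in `A`. `S` also joins these ends by a
path, and paths in `T` are unique. -/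
theorem SimpleGraph.Subgraph.le_of_isAcyclic {G : SimpleGraph V} {T T' S : G.Subgraph}
    {A : Set V} (hT : T.spanningCoe.IsAcyclic) (hT' : T' ≤ T) (hST : S ≤ T)
    (hfin : T'.verts.Finite)
    (hdeg : ∀ x ∈ T'.verts, x ∉ A → ∃ a b, a ≠ b ∧ T'.Adj x a ∧ T'.Adj x b)
    (hS : S.coe.Preconnected) (hA : A ⊆ S.verts) : T' ≤ S := by
  have hle : T'.spanningCoe ≤ T.spanningCoe := Subgraph.spanningCoe_le_of_le hT'
  have hleS : S.spanningCoe ≤ T.spanningCoe := Subgraph.spanningCoe_le_of_le hST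
  have hac : T'.spanningCoe.IsAcyclic := hT.anti hle
  have hadj : ∀ x y, T'.Adj x y → S.Adj x y := by
    intro x y hxy
    have hxy' : T'.spanningCoe.Adj x y := hxy
    have hext := fun {u v : V} => hac.exists_path_extension (u := u) (v := v) (A := A) hfin
      (fun x y h => T'.edge_vert h) hdeg
    obtain ⟨w, hw, q, hq, hxq⟩ := hext hxy'.toWalk (hxy'.isPath_toWalk) (by simp)
    have hxq' : s(x, y) ∈ q.reverse.edges := by simpa using hxq (by simp : s(x, y) ∈ _)
    -- Extending the reversed path moves its other end into `A` as well.
    obtain ⟨z, hz, r, hr, hqr⟩ := hext q.reverse hq.reverse fun hn => by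
      rw [Walk.edges_eq_nil.2 hn] at hxq'
      simp at hxq'
    obtain ⟨s, hs⟩ := (hS ⟨w, hA hw⟩ ⟨z, hA hz⟩).exists_isPath
    let s' : S.spanningCoe.Walk w z := s.map S.coeEmbeddingSpanningCoe.toHom
    have hs' : s'.IsPath := hs.map Subtype.val_injective
    have heq := congrArg Subtype.val
      ((hT.subsingleton_path w z).elim ⟨r.mapLe hle, hr.mapLe hle⟩ ⟨s'.mapLe hleS, hs'.mapLe hleS⟩)
    have h1 : s(x, y) ∈ (r.mapLe hle).edges := by simpa using hqr hxq'
    rw [show r.mapLe hle = s'.mapLe hleS from heq, Walk.edges_mapLe_eq_edges] at h1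
    exact s'.adj_of_mem_edges h1
  refine ⟨fun x hx => ?_, fun x y => hadj x y⟩
  by_cases hxA : x ∈ A
  · exact hA hxA
  · obtain ⟨a, -, -, ha, -⟩ := hdeg x hx hxA
    exact S.edge_vert (hadj x a ha)

end Graph

/-! ### Treetopes: rising edges, lifts and the canopy. -/

section Treetope

variable {E : Type*} [NormedAddCommGroup E] [InnerProductSpace ℝ E]

theorem IsFace.exists_height {P B : Set E} (hB : IsFace P B) :
    ∃ (l : StrongDual ℝ E) (c : ℝ), (∀ x ∈ P, c ≤ l x) ∧ B = {x ∈ P | l x = c} := by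
  rcases B.eq_empty_or_nonempty with rfl | hne
  -- An empty base occurs when `P` is a point; the zero functional never takes the value `-1`.
  · exact ⟨0, -1, by simp, by simp⟩
  · obtain ⟨m, M, hm, h⟩ := hB.exists_functional hne
    exact ⟨-m, -M, by simpa using hm, by simpa using h⟩

variable {P B : Set E}

theorem IsTreetope.ne (h : IsTreetope P B) : B ≠ P := by
  rintro rfl
  have := h.isFacet.2
  omega

theorem IsTreetope.canopy_isLift_le (h : IsTreetope P B) {F F' : Set E}
    (hF' : IsLift P B F F') : canopy F' F ≤ canopy P B := by
  have hP := h.isPolytope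
  refine ⟨hF'.1.vertexSet_subset hP, ?_⟩
  rintro v w ⟨hne, hv, hw, hf, hnF⟩
  refine ⟨hne, hF'.1.vertexSet_subset hP hv, hF'.1.vertexSet_subset hP hw,
    IsFace.trans hP hF'.1 hf, fun hB => hnF ?_⟩
  rw [← hF'.2.2]
  exact Set.subset_inter hf.subset hB

theorem nonempty_of_mem_upperCanopyFaces {G : Set E} (hG : G ∈ upperCanopyFaces P B) :
    G.Nonempty := by
  obtain ⟨-, ⟨x, -, rfl⟩ | ⟨x, y, -, rfl⟩⟩ := hG
  · exact Set.singleton_nonempty x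
  · exact ⟨x, left_mem_segment ℝ x y⟩

theorem isFace_of_mem_upperCanopyFaces {G : Set E} (hG : G ∈ upperCanopyFaces P B) :
    IsFace P G := by
  obtain ⟨-, ⟨x, hx, rfl⟩ | ⟨x, y, hxy, rfl⟩⟩ := hG
  · exact hx
  · exact hxy.2.2.2.1

/-- Rotating about `F` in the direction of the height adds only points above `B`. -/
theorem IsTreetope.exists_isLift (h : IsTreetope P B) {F : Set E} (hF : IsFace B F)
    (hne : F.Nonempty) : ∃ F', IsLift P B F F' := by
  obtain ⟨l, c, hl, hB⟩ := h.isFacet.1.exists_height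
  have hFB := hF.subset
  obtain ⟨p, hp, hpB⟩ : ∃ p ∈ P, p ∉ B := by
    by_contra! hsub
    exact h.ne (h.isFacet.1.subset.antisymm hsub)
  obtain ⟨G, hG, hss, hGc⟩ := IsFace.exists_ssuperset h.isPolytope
    (IsFace.trans h.isPolytope h.isFacet.1 hF) hne (g := l) (c := c)
    (fun x hx => (hB.subset (hFB hx)).2) hp
    ((hl p hp).lt_of_ne fun heq => hpB (hB.ge ⟨hp, heq.symm⟩))
  refine ⟨G, hG, hss.ne', Set.Subset.antisymm (fun x hx => ?_) (Set.subset_inter hss.1 hFB)⟩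
  by_contra hxF
  exact (hGc x hx.1 hxF).ne' (hB.subset hx.2).2

variable [FiniteDimensional ℝ E]

/-- Uniqueness of the rising edge. With `m` exposing `v`, compare the slopes of `l` against `M - m`
along the two edges and rotate about the less steep one; the resulting face is too large for the
treetope condition. -/
theorem IsTreetope.eq_of_isFace_segment_of_le (h : IsTreetope P B) {l : StrongDual ℝ E} {c : ℝ}
    (hl : ∀ x ∈ P, c ≤ l x) (hB : B = {x ∈ P | l x = c}) {v w₁ w₂ : E} (hv : v ∈ vertexSet P)
    (hw₁ : w₁ ∈ vertexSet P) (hw₂ : w₂ ∈ vertexSet P) (h₁ : IsFace P (segment ℝ v w₁))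
    (h₂ : IsFace P (segment ℝ v w₂)) (hv₁ : l v ≤ l w₁) (hc₁ : c < l w₁) (hv₂ : l v ≤ l w₂)
    (hc₂ : c < l w₂) (hne₁ : w₁ ≠ v) (hne₂ : w₂ ≠ v) : w₁ = w₂ := by
  have hP := h.isPolytope
  have hvP := mem_of_mem_vertexSet hv
  obtain ⟨m, M, hm, hvm⟩ := IsFace.exists_functional hv (Set.singleton_nonempty v)
  have hM : m v = M := (hvm.subset rfl).2
  have hlt : ∀ x ∈ P, x ≠ v → m x < M := fun x hx hxv =>
    (hm x hx).lt_of_ne fun h => hxv (hvm.ge ⟨hx, h⟩)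
  wlog hr : (l w₁ - l v) / (M - m w₁) ≤ (l w₂ - l v) / (M - m w₂) generalizing w₁ w₂
  · exact (this hw₂ hw₁ h₂ h₁ hv₂ hc₂ hv₁ hc₁ hne₂ hne₁ (not_le.1 hr).le).symm
  have hm₁ := sub_pos.2 (hlt w₁ (mem_of_mem_vertexSet hw₁) hne₁)
  have hm₂ := sub_pos.2 (hlt w₂ (mem_of_mem_vertexSet hw₂) hne₂)
  set r := (l w₁ - l v) / (M - m w₁) with hrdef
  have hr0 : 0 ≤ r := div_nonneg (sub_nonneg.2 hv₁) hm₁.le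
  rw [le_div_iff₀ hm₂] at hr
  have hr₁ : r * (M - m w₁) = l w₁ - l v := div_mul_cancel₀ _ hm₁.ne'
  by_contra hne
  have hw₂e : w₂ ∉ segment ℝ v w₁ := fun hmem => by
    rcases eq_or_eq_of_mem_vertexSet_of_mem_segment hw₂ hvP (mem_of_mem_vertexSet hw₁) hmem with
      h | h
    · exact hne₂ h
    · exact hne h.symm
  have hvs : v ∈ segment ℝ v w₁ := left_mem_segment ℝ v w₁
  -- a face strictly containing the edge `v w₁` and meeting `B` in at most `v` is too large
  have contra : ∀ G, IsFace P G → segment ℝ v w₁ ⊂ G → (∀ x ∈ G, l x = c → x = v) → False := by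
    intro G hG hss hGB
    have hd := h.dim_le_one G hG fun x hx y hy => by
      rw [hB] at hx hy
      rw [hGB x hx.1 hx.2.2, hGB y hy.1 hy.2.2]
    have h1 := (h₁.mono hG.subset hss.1).polyDim_lt hss.ne
    have h2 := IsFace.one_le_polyDim_of_ssubset (IsFace.mono hv h₁.subset (by simpa using hvs))
      fun heq => hne₁ (by simpa using heq.subset (right_mem_segment ℝ v w₁))
    omega
  -- With `r` the smaller slope, `l + r • m` is constant on the edge `v w₁`, and its value at `w₂`
  -- is at least as large.
  have hseg : ∀ x ∈ segment ℝ v w₁, (l + r • m) x = l v + r * M := by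
    rintro x ⟨a, b, ha, hb, hab, rfl⟩
    simp only [add_apply, smul_apply, smul_eq_mul, map_add, map_smul, hM]
    obtain rfl : a = 1 - b := by linarith
    linear_combination (-b) * hr₁
  by_cases hex : ∃ p ∈ P, l v + r * M < (l + r • m) p
  · obtain ⟨p, hp, hpc⟩ := hex
    obtain ⟨G, hG, hss, hGc⟩ := IsFace.exists_ssuperset hP h₁ ⟨v, hvs⟩ hseg hp hpc
    refine contra G hG hss fun x hx hxc => ?_
    by_cases hxs : x ∈ segment ℝ v w₁
    · obtain ⟨a, b, ha, hb, hab, rfl⟩ := hxs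
      simp only [map_add, map_smul, smul_eq_mul] at hxc
      have hlv := hl v hvP
      have hb0 : b = 0 := by
        by_contra hb0
        have hbpos : 0 < b := lt_of_le_of_ne hb (Ne.symm hb0)
        obtain rfl : a = 1 - b := by linarith
        have := mul_pos hbpos (sub_pos.2 hc₁)
        have := mul_nonneg ha (sub_nonneg.2 hlv)
        linarith
      obtain rfl : a = 1 := by linarith
      simp [hb0]
    · have h1 := hGc x hx hxs
      simp only [add_apply, smul_apply, smul_eq_mul] at h1
      have := mul_nonneg hr0 (sub_nonneg.2 (hm x (hG.subset hx)))
      have := hl v hvP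
      linarith
  · push Not at hex
    -- Here `l + r • m` already supports `P`, and its face contains both edges.
    refine contra _ (isFace_of_forall_le hex) ⟨fun x hx => ⟨h₁.subset hx, hseg x hx⟩, fun hsub =>
      hw₂e (hsub ⟨mem_of_mem_vertexSet hw₂, le_antisymm (hex _ (mem_of_mem_vertexSet hw₂)) ?_⟩)⟩ ?_
    · simp only [add_apply, smul_apply, smul_eq_mul]
      linarith
    · rintro x ⟨hx, hxe⟩ hxc
      simp only [add_apply, smul_apply, smul_eq_mul] at hxe
      by_contra hxv
      have hmx := sub_pos.2 (hlt x hx hxv)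
      have hlv := hl v hvP
      have h1 : r * (M - m x) = l x - l v := by linarith
      have h2 := mul_nonneg hr0 hmx.le
      have h3 : r * (M - m x) = 0 := by linarith
      have h4 : r = 0 := by
        rcases mul_eq_zero.1 h3 with h | h
        · exact h
        · exact absurd h hmx.ne'
      rw [h4] at hr₁
      linarith

/-- At a vertex `v` of `F`, the directions of `F` and of the unique rising edge `v u` span those of
`F'`: a functional vanishing on them but not on `F'` would increase along a further edge at `v`,
which is neither in `F` nor a second rising one. -/
theorem IsTreetope.polyDim_isLift (h : IsTreetope P B) {F F' : Set E} (hne : F.Nonempty)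
    (hF' : IsLift P B F F') : polyDim F' = polyDim F + 1 := by
  have hP := h.isPolytope
  obtain ⟨l, c, hl, hB⟩ := h.isFacet.1.exists_height
  obtain ⟨hF'P, hF'ne, hF'B⟩ := hF'
  have hFF' : IsFace F' F := by
    rw [← hF'B]
    exact (hF'P.inter h.isFacet.1).mono hF'P.subset Set.inter_subset_left
  have hpoly := hP.isFace hF'P
  obtain ⟨v, hv⟩ := (hpoly.isFace hFF').vertexSet_nonempty hne
  have hvF := mem_of_mem_vertexSet hv
  have hvF' : v ∈ vertexSet F' := hFF'.vertexSet_subset hpoly hv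
  have hvP : v ∈ vertexSet P := hF'P.vertexSet_subset hP hvF'
  have hvc : l v = c := (hB.subset (hF'B.ge hvF).2).2
  obtain ⟨p, hp, hpF⟩ : ∃ p ∈ F', p ∉ F := by
    by_contra! hsub
    exact hF'ne (Set.Subset.antisymm hsub hFF'.subset)
  have hlc : ∀ x ∈ F', x ∉ F → c < l x := fun x hx hxF =>
    (hl x (hF'P.subset hx)).lt_of_ne fun heq =>
      hxF (hF'B.subset ⟨hx, hB.ge ⟨hF'P.subset hx, heq.symm⟩⟩)
  obtain ⟨u, hu, hvu, hfu⟩ := hpoly.exists_increasing_edge hvF' l hp (by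
    rw [hvc]
    exact hlc p hp hpF)
  have hlt := hFF'.polyDim_lt hF'ne.symm
  have hspan : vectorSpan ℝ F' ≤ vectorSpan ℝ F ⊔ Submodule.span ℝ {u - v} := by
    rw [vectorSpan_eq_span_vsub_set_right ℝ (hFF'.subset hvF), Submodule.span_le]
    rintro _ ⟨x, hx, rfl⟩
    by_contra hxW
    obtain ⟨q, hq, hq0⟩ := exists_functional_of_notMem hxW
    simp only [vsub_eq_sub, map_sub] at hq
    obtain ⟨w, hw, hvw, hfw⟩ := hpoly.exists_increasing_edge hvF' q hx (by linarith)
    by_cases hwF : w ∈ F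
    · have := hq0 _ (Submodule.mem_sup_left (vsub_mem_vectorSpan ℝ hwF hvF))
      rw [vsub_eq_sub, map_sub] at this
      linarith
    · have hcw := hlc w (mem_of_mem_vertexSet hw) hwF
      have huw : u = w := h.eq_of_isFace_segment_of_le hl hB hvP (hF'P.vertexSet_subset hP hu)
        (hF'P.vertexSet_subset hP hw) (IsFace.trans hP hF'P hfu) (IsFace.trans hP hF'P hfw)
        hvu.le (hvc ▸ hvu) (hvc ▸ hcw.le) hcw (fun heq => by simp [heq] at hvu)
        (fun heq => by simp [heq] at hvw)
      have := hq0 _ (Submodule.mem_sup_right (Submodule.mem_span_singleton_self (u - v)))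
      rw [map_sub, huw] at this
      linarith
  have h1 := Submodule.finrank_mono hspan
  have h2 := Submodule.finrank_add_le_finrank_add_finrank (vectorSpan ℝ F)
    (Submodule.span ℝ {u - v})
  have h3 := finrank_span_singleton (K := ℝ) (v := u - v)
    (sub_ne_zero.2 fun heq => by simp [heq] at hvu)
  rw [polyDim_of_nonempty hne, polyDim_of_nonempty (hne.mono hFF'.subset)] at *
  omega

/-- Both lifts contain the rising edge at a vertex of `F`, so their intersection is also a lift. All
lifts have equal dimension, and a proper face has a smaller one. -/
theorem IsTreetope.isLift_unique (h : IsTreetope P B) {F F₁ F₂ : Set E} (hF : IsFace B F)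
    (hne : F.Nonempty) (h₁ : IsLift P B F F₁) (h₂ : IsLift P B F F₂) : F₁ = F₂ := by
  have hP := h.isPolytope
  obtain ⟨l, c, hl, hB⟩ := h.isFacet.1.exists_height
  have hpB := hP.isFace h.isFacet.1
  obtain ⟨v, hv⟩ := (hpB.isFace hF).vertexSet_nonempty hne
  have hvF := mem_of_mem_vertexSet hv
  have hvB := hF.subset hvF
  have hvP : v ∈ vertexSet P := h.isFacet.1.vertexSet_subset hP (hF.vertexSet_subset hpB hv)
  have hvc : l v = c := (hB.subset hvB).2
  have hedge : ∀ G, IsLift P B F G → ∃ w ∈ vertexSet P, w ∈ G ∧ l v < l w ∧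
      IsFace P (segment ℝ v w) := by
    rintro G ⟨hG, hGne, hGB⟩
    have hFG : F ⊆ G := hGB ▸ Set.inter_subset_left
    obtain ⟨p, hp, hpF⟩ : ∃ p ∈ G, p ∉ F := by
      by_contra! hsub
      exact hGne (Set.Subset.antisymm hsub hFG)
    obtain ⟨w, hw, hvw, hfw⟩ := (hP.isFace hG).exists_increasing_edge
      (IsFace.mono hvP hG.subset (by simpa using hFG hvF)) l hp (by
        rw [hvc]
        exact (hl p (hG.subset hp)).lt_of_ne fun heq =>
          hpF (hGB.subset ⟨hp, hB.ge ⟨hG.subset hp, heq.symm⟩⟩))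
    exact ⟨w, hG.vertexSet_subset hP hw, mem_of_mem_vertexSet hw, hvw, IsFace.trans hP hG hfw⟩
  obtain ⟨w₁, hw₁, hwF₁, hv₁, he₁⟩ := hedge F₁ h₁
  obtain ⟨w₂, hw₂, hwF₂, hv₂, he₂⟩ := hedge F₂ h₂
  obtain rfl : w₁ = w₂ := h.eq_of_isFace_segment_of_le hl hB hvP hw₁ hw₂ he₁ he₂ hv₁.le
    (hvc ▸ hv₁) hv₂.le (hvc ▸ hv₂) (fun heq => by simp [heq] at hv₁)
    (fun heq => by simp [heq] at hv₂)
  have h₁₂ : IsLift P B F (F₁ ∩ F₂) := by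
    refine ⟨h₁.1.inter h₂.1, fun heq => ?_, ?_⟩
    · have := hB.subset (hF.subset (heq.subset ⟨hwF₁, hwF₂⟩))
      linarith [this.2]
    · rw [Set.inter_assoc, h₂.2.2, ← h₁.2.2, Set.inter_eq_right]
      exact fun x hx => hx.1
  have key : ∀ G, IsLift P B F G → F₁ ∩ F₂ ⊆ G → F₁ ∩ F₂ = G := fun G hG hsub => by
    by_contra hcon
    have h1 := (h₁₂.1.mono hG.1.subset hsub).polyDim_lt hcon
    rw [h.polyDim_isLift hne h₁₂, h.polyDim_isLift hne hG] at h1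
    exact h1.false
  exact (key F₁ h₁ Set.inter_subset_left).symm.trans (key F₂ h₂ Set.inter_subset_right)

theorem IsTreetope.isTreetope_isLift (h : IsTreetope P B) {F F' : Set E} (hne : F.Nonempty)
    (hF' : IsLift P B F F') : IsTreetope F' F where
  isPolytope := h.isPolytope.isFace hF'.1
  isFacet := by
    refine ⟨?_, by rw [h.polyDim_isLift hne hF']; ring⟩
    rw [← hF'.2.2]
    exact (hF'.1.inter h.isFacet.1).mono hF'.1.subset Set.inter_subset_left
  dim_le_one G hG hGF := h.dim_le_one G (IsFace.trans h.isPolytope hF'.1 hG) <| by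
    rw [← hF'.2.2, ← Set.inter_assoc, Set.inter_eq_left.2 hG.subset] at hGF
    exact hGF

theorem IsTreetope.isAcyclic_canopy (h : IsTreetope P B) :
    (canopy P B).spanningCoe.IsAcyclic := by
  obtain ⟨l, c, hl, hB⟩ := h.isFacet.1.exists_height
  have hBc : Convex ℝ B := (h.isPolytope.isFace h.isFacet.1).convex
  refine SimpleGraph.isAcyclic_of_subsingleton_ge l fun v a b hva hvb ha hb => ?_
  -- A neighbour at height `c` and not below `v` would put the whole edge in `B`.
  have key : ∀ a, (canopy P B).Adj v a → l v ≤ l a → c < l a := by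
    rintro a ⟨-, hv, ha, -, hnB⟩ hle
    have hvP := mem_of_mem_vertexSet hv
    have haP := mem_of_mem_vertexSet ha
    refine (hl a haP).lt_of_ne fun heq => hnB (hBc.segment_subset ?_ ?_)
    · exact hB.ge ⟨hvP, le_antisymm (heq ▸ hle) (hl v hvP)⟩
    · exact hB.ge ⟨haP, heq.symm⟩
  have hca := key a hva ha
  have hcb := key b hvb hb
  obtain ⟨hne₁, hv, hva, he₁, -⟩ := hva
  obtain ⟨hne₂, -, hvb, he₂, -⟩ := hvb
  exact h.eq_of_isFace_segment_of_le hl hB hv hva hvb he₁ he₂ ha hca hb hcb hne₁.symm hne₂.symm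

/-- For connectedness, a highest vertex not joined to the vertex `a` of the top face `K` cannot
climb further, so it lies in `K`. But `K` misses `B`, hence is a point or a canopy edge. -/
theorem IsTreetope.isTree_canopy (h : IsTreetope P B) : (canopy P B).coe.IsTree := by
  have hP := h.isPolytope
  refine ⟨?_, h.isAcyclic_canopy.embedding (canopy P B).coeEmbeddingSpanningCoe⟩
  obtain ⟨l, c, hl, hB⟩ := h.isFacet.1.exists_height
  obtain ⟨p, hp, hpB⟩ : ∃ p ∈ P, p ∉ B := by
    by_contra! hsub
    exact h.ne (h.isFacet.1.subset.antisymm hsub)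
  have hpc : c < l p := (hl p hp).lt_of_ne fun heq => hpB (hB.ge ⟨hp, heq.symm⟩)
  obtain ⟨t, ht, hmax⟩ := hP.isCompact.exists_isMaxOn ⟨p, hp⟩ l.continuous.continuousOn
  have hct : c < l t := hpc.trans_le (hmax hp)
  have hK := isFace_of_forall_le (m := l) (c := l t) hmax
  set K := {x ∈ P | l x = l t} with hKdef
  have hKB : ∀ x ∈ K, x ∉ B := fun x hx hxB => by linarith [(hB.subset hxB).2, hx.2]
  have hKdim : polyDim K ≤ 1 := h.dim_le_one K hK fun x hx => absurd hx.2 (hKB x hx.1)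
  obtain ⟨a, haK⟩ := (hP.isFace hK).vertexSet_nonempty ⟨t, ht, rfl⟩
  have ha := hK.vertexSet_subset hP haK
  have hreach : ∀ v : (canopy P B).verts, (canopy P B).coe.Reachable v ⟨a, ha⟩ := by
    by_contra! hcon
    have hfin : Finite (canopy P B).verts := hP.finite_vertexSet
    obtain ⟨⟨v, hv⟩, hvn, hvmax⟩ := Set.exists_max_image
      {v : (canopy P B).verts | ¬ (canopy P B).coe.Reachable v ⟨a, ha⟩} (fun v => l v)
      (Set.toFinite _) hcon
    have hvP := mem_of_mem_vertexSet hv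
    by_cases hex : ∃ p ∈ P, l v < l p
    · obtain ⟨p, hp, hvp⟩ := hex
      obtain ⟨w, hw, hvw, hfw⟩ := hP.exists_increasing_edge hv l hp hvp
      have hadj : (canopy P B).Adj v w := by
        refine ⟨fun heq => by simp [heq] at hvw, hv, hw, hfw, fun hsub => ?_⟩
        have := (hB.subset (hsub (right_mem_segment ℝ v w))).2
        linarith [hl v hvP]
      by_cases hwr : (canopy P B).coe.Reachable ⟨w, hw⟩ ⟨a, ha⟩
      · exact hvn ((SimpleGraph.Adj.reachable (by exact hadj)).trans hwr)
      · exact (hvmax ⟨w, hw⟩ hwr).not_gt hvw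
    · push Not at hex
      have hvK : v ∈ K := ⟨hvP, le_antisymm (hmax hvP) (hex t ht)⟩
      have hva : v ≠ a := by
        rintro rfl
        exact hvn (SimpleGraph.Reachable.refl _)
      obtain ⟨b, hb, hba, hKab⟩ := (hP.isFace hK).eq_segment_of_polyDim_le_one hKdim haK
        fun heq => hva (heq.subset hvK)
      have hbP := hK.subset (mem_of_mem_vertexSet hb)
      have hvb : v = b := (eq_or_eq_of_mem_vertexSet_of_mem_segment hv (mem_of_mem_vertexSet ha)
        hbP (hKab.subset hvK)).resolve_left hva
      subst hvb
      have hadj : (canopy P B).Adj v a := by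
        refine ⟨hva, hv, ha, ?_, fun hsub => hKB v hvK (hsub (left_mem_segment ℝ v a))⟩
        rw [segment_symm, ← hKab]
        exact hK
      exact hvn (SimpleGraph.Adj.reachable (by exact hadj))
  have : Nonempty (canopy P B).verts := ⟨⟨a, ha⟩⟩
  exact ⟨fun v w => (hreach v).trans (hreach w).symm⟩

/-- Off `B` every edge of `P` belongs to the canopy, and `P` has dimension at least two; a
functional constant on one edge at `v` finds a second. Over a point base, `P` is a segment whose
upper end is a leaf. -/
theorem IsTreetope.exists_two_adj (h : IsTreetope P B) (hB : 1 ≤ polyDim B) {v : E}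
    (hv : v ∈ vertexSet P) (hvB : v ∉ B) :
    ∃ a b, a ≠ b ∧ (canopy P B).Adj v a ∧ (canopy P B).Adj v b := by
  have hP := h.isPolytope
  have hvP := mem_of_mem_vertexSet hv
  have hdim : 1 < polyDim P := by
    have := h.isFacet.2
    omega
  obtain ⟨a, ha, hav, hfa⟩ := hP.exists_edge hv fun heq => by
    rw [heq, polyDim_singleton] at hdim
    omega
  obtain ⟨q, hqa, x, hx, hqx⟩ := exists_functional_of_one_lt_polyDim hdim hvP a
  obtain ⟨b, hb, hvb, hfb⟩ := hP.exists_increasing_edge hv q hx hqx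
  have hnot : ∀ w, ¬ segment ℝ v w ⊆ B := fun w hsub => hvB (hsub (left_mem_segment ℝ v w))
  exact ⟨a, b, fun heq => by simp [← heq, hqa] at hvb, ⟨hav.symm, hv, ha, hfa, hnot a⟩,
    ⟨fun heq => by simp [heq] at hvb, hv, hb, hfb, hnot b⟩⟩

/-- Vertices of the lift outside `F` are not leaves of its canopy, so
`SimpleGraph.Subgraph.le_of_isAcyclic` applies. -/
theorem IsTreetope.isMinimalSubtree_isLift (h : IsTreetope P B) {F F' : Set E}
    (hF' : IsLift P B F F') (hne : F.Nonempty) (hdim : 1 ≤ polyDim F) :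
    IsMinimalSubtree (canopy P B) (vertexSet F) (canopy F' F) := by
  have hT := h.isTreetope_isLift hne hF'
  refine ⟨⟨h.canopy_isLift_le hF', hT.isTree_canopy,
    hT.isFacet.1.vertexSet_subset hT.isPolytope⟩, ?_⟩
  rintro S ⟨hS, hStree, hFS⟩
  refine SimpleGraph.Subgraph.le_of_isAcyclic h.isAcyclic_canopy (h.canopy_isLift_le hF') hS
    hT.isPolytope.finite_vertexSet (fun v hv hvF => hT.exists_two_adj hdim hv fun hvF' => ?_)
    hStree.connected.preconnected hFS
  exact hvF (IsFace.mono hv hT.isFacet.1.subset (by simpa using hvF'))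

theorem IsTreetope.mem_upperCanopyFaces (h : IsTreetope P B) {G : Set E} (hG : IsFace P G)
    (hne : G.Nonempty) (hGB : Disjoint G B) : G ∈ upperCanopyFaces P B := by
  have hP := h.isPolytope
  have hdim : polyDim G ≤ 1 := h.dim_le_one G hG (by
    rw [hGB.inter_eq]
    exact Set.subsingleton_empty)
  obtain ⟨v, hv⟩ := (hP.isFace hG).vertexSet_nonempty hne
  refine ⟨hGB, ?_⟩
  by_cases hGv : G = {v}
  · exact Or.inl ⟨v, hG.vertexSet_subset hP hv, hGv⟩
  · obtain ⟨w, hw, hwv, hGw⟩ := (hP.isFace hG).eq_segment_of_polyDim_le_one hdim hv hGv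
    refine Or.inr ⟨v, w, ⟨hwv.symm, hG.vertexSet_subset hP hv, hG.vertexSet_subset hP hw,
      hGw ▸ hG, fun hsub => ?_⟩, hGw⟩
    exact Set.disjoint_left.1 hGB (mem_of_mem_vertexSet hv) (hsub (left_mem_segment ℝ v w))

/-- A face `G` that meets `B` either lies in `B` or is a lift of `G ∩ B`. -/
theorem IsTreetope.setOf_isFace_eq (h : IsTreetope P B) :
    {G : Set E | IsFace P G} = {G | IsFace B G} ∪ upperCanopyFaces P B ∪ liftedFaces P B := by
  ext G
  constructor
  · intro hG
    by_cases hGB : Disjoint G B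
    · rcases G.eq_empty_or_nonempty with rfl | hne
      · exact Or.inl (Or.inl isExposed_empty)
      · exact Or.inl (Or.inr (h.mem_upperCanopyFaces hG hne hGB))
    · have hF : IsFace B (G ∩ B) :=
        (IsFace.inter hG h.isFacet.1).mono h.isFacet.1.subset Set.inter_subset_right
      by_cases heq : G = G ∩ B
      · rw [← heq] at hF
        exact Or.inl (Or.inl hF)
      · exact Or.inr ⟨G ∩ B, hF, Set.not_disjoint_iff_nonempty_inter.1 hGB, hG, heq, rfl⟩
  · rintro ((hG | hG) | ⟨F, -, -, hG, -⟩)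
    · exact IsFace.trans h.isPolytope h.isFacet.1 hG
    · exact isFace_of_mem_upperCanopyFaces hG
    · exact hG

end Treetope

theorem mainTheorem3 {E : Type*} [NormedAddCommGroup E] [InnerProductSpace ℝ E]
    [FiniteDimensional ℝ E] (P B : Set E) (hP : IsTreetope P B) :
    -- the canopy is a tree
    (canopy P B).coe.IsTree ∧
    -- the faces of `P` are partitioned into three classes
    {G : Set E | IsFace P G} = {G | IsFace B G} ∪ upperCanopyFaces P B ∪ liftedFaces P B ∧
    Disjoint {G | IsFace B G} (upperCanopyFaces P B) ∧
    Disjoint {G | IsFace B G} (liftedFaces P B) ∧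
    Disjoint (upperCanopyFaces P B) (liftedFaces P B) ∧
    -- every nonempty face of `B` has exactly one lift, with the stated properties
    ∀ F : Set E, IsFace B F → F.Nonempty →
      (∃! F' : Set E, IsLift P B F F') ∧
      ∀ F' : Set E, IsLift P B F F' →
        polyDim F' = polyDim F + 1 ∧
        IsTreetope F' F ∧
        (1 ≤ polyDim F → IsMinimalSubtree (canopy P B) (vertexSet F) (canopy F' F)) := by
  refine ⟨hP.isTree_canopy, hP.setOf_isFace_eq, ?_, ?_, ?_, fun F hF hne => ⟨?_, fun F' hF' =>
    ⟨hP.polyDim_isLift hne hF', hP.isTreetope_isLift hne hF',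
      hP.isMinimalSubtree_isLift hF' hne⟩⟩⟩
  · rw [Set.disjoint_left]
    intro G hG hGu
    obtain ⟨x, hx⟩ := nonempty_of_mem_upperCanopyFaces hGu
    exact Set.disjoint_left.1 hGu.1 hx (IsFace.subset hG hx)
  · rw [Set.disjoint_left]
    rintro G hG ⟨F, -, -, -, hGF, hGB⟩
    exact hGF ((Set.inter_eq_left.2 (IsFace.subset hG)).symm.trans hGB)
  · rw [Set.disjoint_left]
    rintro G ⟨hG, -⟩ ⟨F, -, hne, -, -, hGB⟩
    exact hne.ne_empty (hGB.symm.trans hG.inter_eq)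
  · obtain ⟨F', hF'⟩ := hP.exists_isLift hF hne
    exact ⟨F', hF', fun G hG => hP.isLift_unique hF hne hG hF'⟩
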